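/- Let $p>2$ be a prime, let $K/\mathbb{Q}_p$ be a finite extension, let $\overline K$ be an algebraic closure of $K$, and put $G_K=\mathrm{Gal}(\overline K/K)$. Let $\pi$ be a uniformizer of $K$ and let $(\pi_n)_{n\ge 0}$ be a sequence in $\overline K$ with $\pi_0=\pi$ and $\pi_{n+1}^p=\pi_n$ for all $n\ge 0$. Put $K_\infty=\bigcup_{n\ge 0}K(\pi_n)$ and $G_\infty=\mathrm{Gal}(\overline K/K_\infty)\subseteq G_K$. Let $k_E$ be a finite field of characteristic $p$ (for example the residue field of a finite extension $E/\mathbb{Q}_p$), and let $\overline\varepsilon_p\colon G_K\to\mathbb{F}_p^\times\subseteq k_E^\times$ be the reduction modulo $p$ of the $p$-adic cyclotomic character. Let $\overline\zeta_1,\dots,\overline\zeta_d\colon G_K\to k_E^\times$ be continuous characters such that, for every $i$, $\overline\zeta_i\neq\mathbb{1}$ (the trivial character) and $\overline\zeta_i\neq\overline\varepsilon_p$. Let $W$ be a continuous $k_E$-linear representation of $G_K$ (with the discrete topology on $W$) which is a successive extension of $\overline\zeta_1,\dots,\overline\zeta_d$; that is, there is a filtration $0=\mathrm{Fil}^0W\subseteq\mathrm{Fil}^1W\subseteq\dots\subseteq\mathrm{Fil}^dW=W$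 by $G_K$-stable $k_E$-subspaces such that, for $1\le i\le d$, the quotient $\mathrm{Fil}^iW/\mathrm{Fil}^{i-1}W$ is one-dimensional with $G_K$ acting through $\overline\zeta_i$. Then the restriction map on continuous cohomology $$H^1(G_K,W)\longrightarrow H^1(G_\infty,W)$$ is injective. -/

import Mathlib

open scoped ContRepresentation

universe u v w t

/-- The reduction `G_K → 𝔽ˣ` of the `p`-adic cyclotomic character `G_K → ℤ_pˣ`, where `𝔽` is a
field of characteristic `p`. -/
noncomputable def modPCyclotomicCharacter (p : ℕ) [Fact p.Prime] (K : Type u) (Kbar : Type v)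
    [Field K] [Field Kbar] [Algebra K Kbar] (𝔽 : Type t) [Field 𝔽] [CharP 𝔽 p] :
    Gal(Kbar/K) →* 𝔽ˣ :=
  (Units.map ((ZMod.castHom (dvd_refl p) 𝔽).comp PadicInt.toZMod : ℤ_[p] →* 𝔽)).comp
    ((cyclotomicCharacter Kbar p).comp (MulSemiringAction.toRingAut Gal(Kbar/K) Kbar))

/-- The subgroup `Gal(Kbar/K_∞)` of `Gal(Kbar/K)`, where `K_∞ = ⋃ₙ K(ϖₙ)` is the field generated
over `K` by the sequence `ϖ`. -/
def galInfty (K : Type u) {Kbar : Type v} [Field K] [Field Kbar] [Algebra K Kbar]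
    (ϖ : ℕ → Kbar) : Subgroup Gal(Kbar/K) :=
  (IntermediateField.adjoin K (Set.range ϖ)).fixingSubgroup

/-- `ρ` is a successive extension of the characters `ζ₁, …, ζ_d`: there is a filtration
`0 = Fil⁰ ⊆ Fil¹ ⊆ … ⊆ Fil^d = W` by `G`-stable subspaces, together with `G`-equivariant exact
sequences `0 → Fil^{i-1} → Fil^i → 𝔽(ζ_i) → 0`. -/
def IsSuccessiveExtension {𝔽 : Type t} {G : Type v} {W : Type w} [Field 𝔽] [Group G]
    [AddCommGroup W] [Module 𝔽 W] (ρ : Representation 𝔽 G W) {d : ℕ}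
    (ζ : Fin d → (G →* 𝔽ˣ)) : Prop :=
  ∃ Fil : Fin (d + 1) → Submodule 𝔽 W,
    Fil 0 = ⊥ ∧ Fil (Fin.last d) = ⊤ ∧ Monotone Fil ∧
    ∃ stable : ∀ i g, ∀ x ∈ Fil i, ρ g x ∈ Fil i,
    ∀ i : Fin d, ∃ f : Fil i.succ →ₗ[𝔽] 𝔽,
      Function.Surjective f ∧
      (∀ x : Fil i.succ, f x = 0 ↔ (x : W) ∈ Fil i.castSucc) ∧
      ∀ (g : G) (x : Fil i.succ),
        f ⟨ρ g x, stable i.succ g x x.2⟩ = (ζ i g : 𝔽) * f x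

/-- The restriction map `Hⁿ(G, A) → Hⁿ(H, A)` on continuous cohomology, for a subgroup `H` of `G`
with the subspace topology. -/
noncomputable def restrictionMap {k : Type t} {G : Type v} [Ring k] [TopologicalSpace k]
    [Group G] [TopologicalSpace G] [IsTopologicalGroup G] (H : Subgroup G)
    (A : TopRep.{max v w} k G) (n : ℕ) :
    continuousCohomology.{t, v, w} n A ⟶
      continuousCohomology.{t, v, w} n (TopRep.res H.subtype A) :=
  ContinuousCohomology.map.{t, v, w} (X := A) (Y := TopRep.res H.subtype A)
    { H.subtype with continuous_toFun := continuous_subtype_val } (CategoryTheory.CategoryStruct.id _) n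

section TopModuleCatHomology

open CategoryTheory

variable {R : Type u} [Ring R] [TopologicalSpace R]

/-- A chain map of cochain complexes of topological modules is injective on cohomology in degree
`n + 1` if a cocycle that becomes a coboundary in the target is already a coboundary. -/
theorem TopModuleCat.homologyMap_injective_of_forall {C D : CochainComplex (TopModuleCat.{v} R) ℕ}
    (φ : C ⟶ D) (n : ℕ)
    (h : ∀ x : C.X (n + 1), (C.d (n + 1) (n + 2)).hom x = 0 →
      (∃ y : D.X n, (D.d n (n + 1)).hom y = (φ.f (n + 1)).hom x) →
      ∃ y : C.X n, (C.d n (n + 1)).hom y = x) :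
    Function.Injective (HomologicalComplex.homologyMap φ (n + 1)) := by
  have hπ : Function.Surjective (C.homologyπ (n + 1)) := by
    have : Epi ((forget₂ (TopModuleCat.{v} R) (ModuleCat R)).map (C.homologyπ (n + 1))) :=
      inferInstance
    exact (ModuleCat.epi_iff_surjective _).1 this
  have hi (E : CochainComplex (TopModuleCat.{v} R) ℕ) :
      Function.Injective (E.iCycles (n + 1)) := by
    have : Mono ((forget₂ (TopModuleCat.{v} R) (ModuleCat R)).map (E.iCycles (n + 1))) :=
      inferInstance
    exact (ModuleCat.mono_iff_injective _).1 this
  have hker (E : CochainComplex (TopModuleCat.{v} R) ℕ) (z : E.cycles (n + 1))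
      (hz : E.homologyπ (n + 1) z = 0) : ∃ y : E.X n, E.toCycles n (n + 1) y = z := by
    let desc := (E.homologyIsCokernel n (n + 1) (by simp)).desc
      (Limits.CokernelCofork.ofπ (TopModuleCat.cokerπ (E.toCycles n (n + 1)))
        (TopModuleCat.comp_cokerπ _))
    have hdesc : E.homologyπ (n + 1) ≫ desc = TopModuleCat.cokerπ (E.toCycles n (n + 1)) :=
      (E.homologyIsCokernel n (n + 1) (by simp)).fac _ Limits.WalkingParallelPair.one
    have h0 : TopModuleCat.cokerπ (E.toCycles n (n + 1)) z = 0 := by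
      rw [← hdesc, ConcreteCategory.comp_apply, hz, map_zero]
    exact (Submodule.Quotient.mk_eq_zero _).1 h0
  refine (injective_iff_map_eq_zero (HomologicalComplex.homologyMap φ (n + 1)).hom).2 fun x hx ↦ ?_
  obtain ⟨z, rfl⟩ := hπ x
  have hx' : D.homologyπ (n + 1) (HomologicalComplex.cyclesMap φ (n + 1) z) = 0 := by
    rw [← ConcreteCategory.comp_apply, ← HomologicalComplex.homologyπ_naturality,
      ConcreteCategory.comp_apply]
    exact hx
  obtain ⟨y, hy⟩ := hker D _ hx'
  obtain ⟨y', hy'⟩ := h (C.iCycles (n + 1) z)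
    (by
      change (C.iCycles (n + 1) ≫ C.d (n + 1) (n + 2)) z = 0
      rw [C.iCycles_d]; rfl)
    ⟨y, by
      change _ = (C.iCycles (n + 1) ≫ φ.f (n + 1)) z
      rw [← HomologicalComplex.cyclesMap_i, ConcreteCategory.comp_apply, ← hy,
        ← ConcreteCategory.comp_apply, D.toCycles_i]⟩
  have hz : C.toCycles n (n + 1) y' = z := hi C (by
    rw [← ConcreteCategory.comp_apply, C.toCycles_i]
    exact hy')
  change C.homologyπ (n + 1) z = 0
  rw [← hz, ← ConcreteCategory.comp_apply, C.toCycles_comp_homologyπ]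
  rfl

end TopModuleCatHomology

/-- If every continuous crossed homomorphism on `G` that vanishes on `H` is zero, then restriction
to `H` is injective on the first continuous cohomology. -/
theorem restrictionMap_one_injective {k : Type t} {G : Type v} [Ring k] [TopologicalSpace k]
    [Group G] [TopologicalSpace G] [IsTopologicalGroup G] (H : Subgroup G)
    {W : Type (max v w)} [AddCommGroup W] [Module k W] [TopologicalSpace W]
    [IsTopologicalAddGroup W] [ContinuousSMul k W] (ρ : ContRepresentation k G W)
    (hρ : Continuous fun x : G × W ↦ ρ x.1 x.2)
    (h : ∀ f : G → W, Continuous f → (∀ g g', f (g * g') = f g + ρ g (f g')) →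
      (∀ g ∈ H, f g = 0) → ∀ g, f g = 0) :
    Function.Injective (restrictionMap.{v, w, t} H (TopRep.of ρ) 1) := by
  refine TopModuleCat.homologyMap_injective_of_forall _ 0 fun x hx hy ↦ ?_
  obtain ⟨y, hy⟩ := hy
  replace hx := congrArg Subtype.val hx
  rw [TopRep.homogeneousCochains.d_apply] at hx
  replace hy := congrArg Subtype.val hy
  rw [TopRep.homogeneousCochains.d_apply] at hy
  let σ : C(G, C(G, W)) := x.1
  let τ : C(H, W) := y.1
  have hσ (a b c : G) : σ b c - (σ a c - σ a b) = 0 :=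
    DFunLike.congr_fun (DFunLike.congr_fun (DFunLike.congr_fun hx a) b) c
  have hστ (a b : H) : τ b - τ a = σ a b := DFunLike.congr_fun (DFunLike.congr_fun hy a) b
  have hσ_inv (g a b : G) : ρ g (σ (g⁻¹ * a) (g⁻¹ * b)) = σ a b :=
    DFunLike.congr_fun (DFunLike.congr_fun (x.2 g) a) b
  have hτ_inv (g a : H) : ρ g (τ (g⁻¹ * a)) = τ a := DFunLike.congr_fun (y.2 g) a
  have hτ1 (g : H) : ρ g (τ 1) = τ g := by simpa using hτ_inv g g
  have hρc (v : W) : Continuous fun g ↦ ρ g v := hρ.comp (by fun_prop : Continuous fun g ↦ (g, v))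
  have hf := h (fun g ↦ σ 1 g - (ρ g (τ 1) - τ 1))
    ((σ 1).continuous.sub ((hρc _).sub continuous_const))
    (fun g g' ↦ by
      have h1 := hσ 1 g (g * g')
      have h2 := hσ_inv g g (g * g')
      simp only [inv_mul_cancel, inv_mul_cancel_left] at h2
      simp only [map_mul, map_sub, h2, mul_apply_eq_comp]
      rw [sub_eq_zero] at h1
      rw [h1]
      abel)
    (fun g hg ↦ by
      have := hστ 1 ⟨g, hg⟩
      rw [← hτ1] at this
      simp only [OneMemClass.coe_one] at this
      rw [← this]
      exact sub_self _)
  let υ : C(G, W) := ⟨fun g ↦ ρ g (τ 1), hρc _⟩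
  obtain ⟨y', hy'⟩ : ∃ y' : (TopRep.homogeneousCochains (TopRep.of ρ)).X 0, y'.1 = υ := by
    refine ⟨⟨υ, fun g ↦ ContinuousMap.ext fun a ↦ ?_⟩, rfl⟩
    have : ρ g (ρ (g⁻¹ * a) (τ 1)) = ρ a (τ 1) := by
      rw [← mul_apply_eq_comp, ← map_mul, mul_inv_cancel_left]
    exact this
  refine ⟨y', Subtype.ext ?_⟩
  rw [TopRep.homogeneousCochains.d_apply, hy']
  refine ContinuousMap.ext fun a ↦ ContinuousMap.ext fun b ↦ ?_
  change ρ b (τ 1) - ρ a (τ 1) = σ a b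
  have h1 := hσ 1 a b
  have ha := hf a
  have hb := hf b
  rw [sub_eq_zero] at h1 ha hb
  rw [h1, ha, hb]
  abel

section CrossedHomomorphism

variable {G : Type v} [Group G] {𝔽 : Type t} [Field 𝔽]

/-- Every element of `G` is a product of an element of `H` and one of `N`, for subgroups of coprime
index with `N` normal. -/
theorem Subgroup.exists_mul_eq_of_coprime_index {H N : Subgroup G} [N.Normal]
    (h : H.index.Coprime N.index) (g : G) : ∃ a ∈ H, ∃ b ∈ N, a * b = g := by
  have htop : H ⊔ N = ⊤ := Subgroup.index_eq_one.1 <| Nat.eq_one_of_dvd_coprimes h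
    (Subgroup.index_dvd_of_le le_sup_left) (Subgroup.index_dvd_of_le le_sup_right)
  have hg : g ∈ ((H ⊔ N : Subgroup G) : Set G) := by simp [htop]
  rwa [Subgroup.mul_normal, Set.mem_mul] at hg

/-- The common kernel of two characters valued in a finite field of characteristic `p` has index
prime to `p`. -/
theorem coprime_index_ker_inf_ker {p : ℕ} [Fact p.Prime] [Finite 𝔽] [CharP 𝔽 p]
    (ζ χ : G →* 𝔽ˣ) : p.Coprime (ζ.ker ⊓ χ.ker).index := by
  have hcop : p.Coprime (Nat.card 𝔽ˣ) := by
    have := Fintype.ofFinite 𝔽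
    have h0 : p ∣ Nat.card 𝔽 := by
      rw [Nat.card_eq_fintype_card, ← CharP.cast_eq_zero_iff 𝔽 p, FiniteField.cast_card_eq_zero]
    rw [Nat.card_units, (Fact.out : p.Prime).coprime_iff_not_dvd]
    intro h1
    have := (Nat.dvd_sub_iff_right Nat.card_pos h0).1 h1
    exact (Fact.out : p.Prime).one_lt.ne' (Nat.dvd_one.1 this)
  rw [← MonoidHom.ker_prod, Subgroup.index_ker]
  refine Nat.Coprime.coprime_dvd_right (Subgroup.card_subgroup_dvd_card _) ?_
  rw [Nat.card_prod]
  exact hcop.mul_right hcop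

/-- A function `c`, satisfying the crossed homomorphism relation for the character `ζ` on `H'` and
vanishing on `H ≤ H'`, vanishes on `H'` when `H` acts on `H' ⊓ N` modulo `H` through a character `χ`
different from `ζ`, where `N` is the common kernel of `ζ` and `χ`. -/
theorem crossedHom_eq_zero_of_character_ne {ζ χ : G →* 𝔽ˣ} (hne : ζ ≠ χ) {H H' : Subgroup G}
    (hle : H ≤ H') (hsup : ∀ g, ∃ a ∈ H, ∃ b ∈ ζ.ker ⊓ χ.ker, a * b = g)
    (hconj : ∀ a ∈ H, ∃ m : ℕ, (m : 𝔽) = χ a ∧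
      ∀ b ∈ H', b ∈ ζ.ker ⊓ χ.ker → (b ^ m)⁻¹ * (a * b * a⁻¹) ∈ H)
    {c : G → 𝔽} (hc : ∀ g ∈ H', ∀ g' ∈ H', c (g * g') = c g + ζ g * c g')
    (hcH : ∀ g ∈ H, c g = 0) : ∀ g ∈ H', c g = 0 := by
  have hζ {b : G} (hb : b ∈ ζ.ker ⊓ χ.ker) : (ζ b : 𝔽) = 1 := by
    rw [MonoidHom.mem_ker.1 hb.1, Units.val_one]
  have hpow {b : G} (hb' : b ∈ H') (hb : b ∈ ζ.ker ⊓ χ.ker) (m : ℕ) : c (b ^ m) = m * c b := by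
    induction m with
    | zero => simp [hcH 1 H.one_mem]
    | succ m ih =>
      rw [pow_succ, hc _ (H'.pow_mem hb' m) _ hb', ih, map_pow, Units.val_pow_eq_pow_val, hζ hb,
        one_pow, Nat.cast_succ]
      ring
  have hker {b : G} (hb' : b ∈ H') (hb : b ∈ ζ.ker ⊓ χ.ker) : c b = 0 := by
    by_contra hcb
    refine hne (MonoidHom.ext fun g ↦ ?_)
    obtain ⟨a, ha, d, hd, rfl⟩ := hsup g
    rw [map_mul, map_mul, MonoidHom.mem_ker.1 hd.1, MonoidHom.mem_ker.1 hd.2, mul_one, mul_one]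
    obtain ⟨m, hm, hma⟩ := hconj a ha
    have h1 : c (a * b * a⁻¹) = ζ a * c b := by
      rw [hc _ (H'.mul_mem (hle ha) hb') _ (H'.inv_mem (hle ha)), hc _ (hle ha) _ hb', hcH a ha,
        hcH _ (H.inv_mem ha)]
      ring
    have h2 : c (a * b * a⁻¹) = m * c b := by
      have h3 : a * b * a⁻¹ = b ^ m * ((b ^ m)⁻¹ * (a * b * a⁻¹)) := by group
      rw [h3, hc _ (H'.pow_mem hb' m) _ (hle (hma b hb' hb)), hcH _ (hma b hb' hb), hpow hb' hb]
      ring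
    exact Units.ext (by rw [← hm]; exact mul_right_cancel₀ hcb (h1.symm.trans h2))
  intro g hg
  obtain ⟨a, ha, b, hb, rfl⟩ := hsup g
  have hb' : b ∈ H' := by simpa using H'.mul_mem (H'.inv_mem (hle ha)) hg
  rw [hc _ (hle ha) _ hb', hcH a ha, hker hb' hb]
  ring

/-- Dévissage: a crossed homomorphism valued in a successive extension of characters vanishes on a
subgroup if this holds for functions satisfying the crossed homomorphism relation for each of the
characters. -/
theorem IsSuccessiveExtension.crossedHom_eq_zero {W : Type w} [AddCommGroup W] [Module 𝔽 W]
    {ρ : Representation 𝔽 G W} {d : ℕ} {ζ : Fin d → (G →* 𝔽ˣ)} (hρ : IsSuccessiveExtension ρ ζ)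
    {H H' : Subgroup G} (hle : H ≤ H')
    (hζ : ∀ i, ∀ c : G → 𝔽, (∀ g ∈ H', ∀ g' ∈ H', c (g * g') = c g + ζ i g * c g') →
      (∀ g ∈ H, c g = 0) → ∀ g ∈ H', c g = 0)
    {f : G → W} (hf : ∀ g g', f (g * g') = f g + ρ g (f g')) (hfH : ∀ g ∈ H, f g = 0) :
    ∀ g ∈ H', f g = 0 := by
  obtain ⟨Fil, hbot, htop, -, stable, hq⟩ := hρ
  have key (i : Fin (d + 1)) : ∀ g ∈ H', f g ∈ Fil i := by
    induction i using Fin.reverseInduction with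
    | last => simp [htop]
    | cast i ih =>
      obtain ⟨q, -, hker, hequiv⟩ := hq i
      classical
      let c : G → 𝔽 := fun g ↦ if hg : f g ∈ Fil i.succ then q ⟨f g, hg⟩ else 0
      have hc {g : G} (hg : g ∈ H') : c g = q ⟨f g, ih g hg⟩ := dif_pos (ih g hg)
      have h0 := hζ i c
        (fun g hg g' hg' ↦ by
          rw [hc hg, hc hg', hc (H'.mul_mem hg hg'), ← hequiv, ← map_add]
          exact congrArg q (Subtype.ext (hf g g')))
        (fun g hg ↦ by
          rw [hc (hle hg), hker]
          simp [hfH g hg])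
      exact fun g hg ↦ (hker _).1 ((hc hg).symm.trans (h0 g hg))
  intro g hg
  simpa [hbot] using key 0 g hg

end CrossedHomomorphism

section PadicKummerTower

open Polynomial IntermediateField

variable {p : ℕ} {K : Type u} [Field K] {Kbar : Type v} [Field Kbar] [Algebra K Kbar]

/-- Reducing a `p`-adic integer to `ZMod (p ^ 1)` or to `ZMod p` gives the same element of a field
of characteristic `p`. -/
theorem PadicInt.natCast_val_toZModPow_one [Fact p.Prime] {𝔽 : Type t} [Field 𝔽] [CharP 𝔽 p]
    (x : ℤ_[p]) :
    (((PadicInt.toZModPow 1 x).val : ℕ) : 𝔽) =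
      (ZMod.castHom (dvd_refl p) 𝔽).comp PadicInt.toZMod x := by
  set φ : ℤ_[p] →+* 𝔽 := (ZMod.castHom (dvd_refl p) 𝔽).comp PadicInt.toZMod
  have hx : x - ((PadicInt.toZModPow 1 x).val : ℕ) ∈ Ideal.span {(p : ℤ_[p]) ^ 1} := by
    rw [← PadicInt.ker_toZModPow, RingHom.mem_ker, map_sub, map_natCast, ZMod.natCast_val,
      ZMod.cast_id', id, sub_self]
  obtain ⟨y, hy⟩ := Ideal.mem_span_singleton.1 hx
  have h := congrArg φ hy
  rw [map_sub, map_natCast, map_mul, map_pow, map_natCast φ p, CharP.cast_eq_zero 𝔽 p,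
    zero_pow one_ne_zero, zero_mul, sub_eq_zero] at h
  exact h.symm

/-- The action on `p`-th roots of unity is through the mod `p` cyclotomic character. -/
theorem modPCyclotomicCharacter_spec [Fact p.Prime] [∀ i, HasEnoughRootsOfUnity Kbar (p ^ i)]
    (𝔽 : Type t) [Field 𝔽] [CharP 𝔽 p] (g : Gal(Kbar/K)) :
    ∃ m : ℕ, (m : 𝔽) = modPCyclotomicCharacter p K Kbar 𝔽 g ∧
      ∀ x : Kbar, x ^ p = 1 → g x = x ^ m :=
  ⟨_, PadicInt.natCast_val_toZModPow_one _, fun x hx ↦ cyclotomicCharacter.spec p (n := 1)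
    (MulSemiringAction.toRingAut Gal(Kbar/K) Kbar g) x (by rwa [pow_one])⟩

theorem apply_eq_self_of_mem_ker_modPCyclotomicCharacter [Fact p.Prime]
    [∀ i, HasEnoughRootsOfUnity Kbar (p ^ i)] {𝔽 : Type t} [Field 𝔽] [CharP 𝔽 p]
    {g : Gal(Kbar/K)} (hg : g ∈ (modPCyclotomicCharacter p K Kbar 𝔽).ker) {x : Kbar}
    (hx : x ^ p = 1) : g x = x := by
  obtain ⟨m, hm, h⟩ := modPCyclotomicCharacter_spec (p := p) 𝔽 g
  rw [MonoidHom.mem_ker.1 hg, Units.val_one, ← Nat.cast_one, CharP.natCast_eq_natCast 𝔽 p] at hm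
  rw [h x hx, pow_eq_pow_of_modEq hm hx, pow_one]

theorem mem_fixingSubgroup_adjoin_simple_iff {x : Kbar} {g : Gal(Kbar/K)} :
    g ∈ K⟮x⟯.fixingSubgroup ↔ g x = x := by
  have h : K⟮x⟯.fixingSubgroup = MulAction.stabilizer Gal(Kbar/K) x := by
    ext g
    rw [← Subgroup.zpowers_le, ← IntermediateField.le_iff_le, adjoin_simple_le_iff,
      IntermediateField.mem_fixedField_iff]
    constructor
    · exact fun h ↦ h g (Subgroup.mem_zpowers g)
    · exact fun h f hf ↦ Subgroup.zpowers_le.2 (MulAction.mem_stabilizer_iff.2 h) hf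
  rw [h, MulAction.mem_stabilizer_iff, AlgEquiv.smul_def]

/-- An irreducible element of an integral closure is not a perfect power in the field. -/
theorem Irreducible.pow_ne_of_integralClosure {R : Type w} [CommRing R] [Algebra R K]
    {π : integralClosure R K} (hπ : Irreducible π) {n : ℕ} (hn : 1 < n) (b : K) :
    b ^ n ≠ π := by
  intro h
  have hb : IsIntegral R b := IsIntegral.of_pow (zero_lt_one.trans hn) (h ▸ π.2)
  have h' : (⟨b, hb⟩ : integralClosure R K) ^ n = π := Subtype.ext h
  exact not_irreducible_pow hn.ne' (h' ▸ hπ)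

variable {ϖ : ℕ → Kbar}

theorem pow_pow_eq_of_succ_pow_eq (hϖ_succ : ∀ n, ϖ (n + 1) ^ p = ϖ n) (n : ℕ) :
    ϖ n ^ p ^ n = ϖ 0 := by
  induction n with
  | zero => simp
  | succ n ih => rw [pow_succ', pow_mul, hϖ_succ, ih]

/-- The field generated by a `p ^ n`-th root of an element that is not a `p`-th power has Galois
group of index `p ^ n`. -/
theorem index_fixingSubgroup_adjoin_simple [Fact p.Prime] (hp : 2 < p) [IsGalois K Kbar] {a : K}
    (ha : ∀ b : K, b ^ p ≠ a) {x : Kbar} {n : ℕ} (hx : x ^ p ^ n = algebraMap K Kbar a) :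
    K⟮x⟯.fixingSubgroup.index = p ^ n := by
  have hp0 : p ^ n ≠ 0 := pow_ne_zero _ (Fact.out : p.Prime).ne_zero
  rw [← finrank_eq_fixingSubgroup_index, adjoin.finrank (Algebra.IsIntegral.isIntegral x),
    ← minpoly.eq_of_irreducible_of_monic
      (X_pow_sub_C_irreducible_of_prime_pow Fact.out hp.ne' n ha) (by simp [hx])
      (monic_X_pow_sub_C a hp0), natDegree_X_pow_sub_C]

/-- An open set containing `Gal(Kbar/K_∞)` contains the Galois group of some finite layer. -/
theorem exists_fixingSubgroup_adjoin_subset [IsGalois K Kbar]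
    (hϖ_succ : ∀ n, ϖ (n + 1) ^ p = ϖ n) {U : Set Gal(Kbar/K)} (hU : IsOpen U)
    (h : ∀ g ∈ galInfty K ϖ, g ∈ U) : ∃ n, ∀ g ∈ K⟮ϖ n⟯.fixingSubgroup, g ∈ U := by
  have hcl (n : ℕ) : IsClosed (K⟮ϖ n⟯.fixingSubgroup : Set Gal(Kbar/K)) := by
    have := adjoin.finiteDimensional (Algebra.IsIntegral.isIntegral (R := K) (ϖ n))
    exact K⟮ϖ n⟯.fixingSubgroup_isClosed
  have hanti : Antitone fun n ↦ (K⟮ϖ n⟯.fixingSubgroup : Set Gal(Kbar/K)) :=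
    antitone_nat_of_succ_le fun n g hg ↦ by
      rw [SetLike.mem_coe, mem_fixingSubgroup_adjoin_simple_iff] at hg ⊢
      rw [← hϖ_succ, map_pow, hg]
  refine exists_subset_nhds_of_isCompact' hanti.directed_ge (fun n ↦ (hcl n).isCompact) hcl
    fun g hg ↦ hU.mem_nhds (h g ?_)
  simp only [Set.mem_iInter, SetLike.mem_coe, mem_fixingSubgroup_adjoin_simple_iff] at hg
  rw [galInfty, ← Subgroup.zpowers_le, ← IntermediateField.le_iff_le, adjoin_le_iff]
  rintro _ ⟨n, rfl⟩
  refine (IntermediateField.mem_fixedField_iff _ _).2 fun f hf ↦ ?_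
  have : Subgroup.zpowers g ≤ MulAction.stabilizer Gal(Kbar/K) (ϖ n) :=
    Subgroup.zpowers_le.2 (MulAction.mem_stabilizer_iff.2 (hg n))
  exact this hf

/-- One layer of the Kummer tower: a function satisfying the crossed homomorphism relation for a
character other than the cyclotomic one over `K(x ^ p)`, and vanishing over `K(x)`, is zero. -/
theorem crossedHom_eq_zero_of_adjoin_pow [Fact p.Prime] [∀ i, HasEnoughRootsOfUnity Kbar (p ^ i)]
    {𝔽 : Type t} [Field 𝔽] [Finite 𝔽] [CharP 𝔽 p] {ζ : Gal(Kbar/K) →* 𝔽ˣ}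
    (hζ : ζ ≠ modPCyclotomicCharacter p K Kbar 𝔽) {x y : Kbar} (hx0 : x ≠ 0) (hxy : x ^ p = y)
    {n : ℕ} (hindex : K⟮x⟯.fixingSubgroup.index = p ^ n) {c : Gal(Kbar/K) → 𝔽}
    (hc : ∀ g ∈ K⟮y⟯.fixingSubgroup, ∀ g' ∈ K⟮y⟯.fixingSubgroup,
      c (g * g') = c g + ζ g * c g')
    (hcx : ∀ g ∈ K⟮x⟯.fixingSubgroup, c g = 0) : ∀ g ∈ K⟮y⟯.fixingSubgroup, c g = 0 := by
  refine crossedHom_eq_zero_of_character_ne hζ ?_ (Subgroup.exists_mul_eq_of_coprime_index ?_) ?_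
    hc hcx
  · intro g hg
    rw [mem_fixingSubgroup_adjoin_simple_iff] at hg ⊢
    rw [← hxy, map_pow, hg]
  · rw [hindex]
    exact (coprime_index_ker_inf_ker ζ _).pow_left n
  · intro a ha
    obtain ⟨m, hm, hma⟩ := modPCyclotomicCharacter_spec (p := p) 𝔽 a
    refine ⟨m, hm, fun b hb hbN ↦ ?_⟩
    rw [mem_fixingSubgroup_adjoin_simple_iff] at ha hb ⊢
    set r : Kbar := b x / x with hr
    have hbx : b x = r * x := by rw [hr, div_mul_cancel₀ _ hx0]
    have hrp : r ^ p = 1 := by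
      have hy0 : y ≠ 0 := hxy ▸ pow_ne_zero p hx0
      rw [hr, div_pow, ← map_pow, hxy, hb, div_self hy0]
    have hbr : b r = r := apply_eq_self_of_mem_ker_modPCyclotomicCharacter hbN.2 hrp
    have hbm (k : ℕ) : (b ^ k) x = r ^ k * x := by
      induction k with
      | zero => simp
      | succ k ih => rw [pow_succ', AlgEquiv.mul_apply, ih, map_mul, map_pow, hbr, hbx]; ring
    have hax : a⁻¹ x = x := by
      conv_lhs => rw [← ha]
      rw [← AlgEquiv.mul_apply, inv_mul_cancel, AlgEquiv.one_apply]
    rw [AlgEquiv.mul_apply, AlgEquiv.mul_apply, AlgEquiv.mul_apply, hax, hbx, map_mul, ha,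
      hma r hrp, ← hbm, ← AlgEquiv.mul_apply, inv_mul_cancel, AlgEquiv.one_apply]

end PadicKummerTower

theorem mainTheorem8 {p : ℕ} [Fact p.Prime] (hp : 2 < p)
    {K : Type u} [Field K] [Algebra ℚ_[p] K] [FiniteDimensional ℚ_[p] K]
    {Kbar : Type v} [Field Kbar] [Algebra K Kbar] [IsAlgClosure K Kbar]
    (π : integralClosure (PadicInt.subring p) K) (hπ : Irreducible π)
    (ϖ : ℕ → Kbar) (hϖ_zero : ϖ 0 = algebraMap K Kbar π)
    (hϖ_succ : ∀ n, ϖ (n + 1) ^ p = ϖ n)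
    {𝔽 : Type t} [Field 𝔽] [Finite 𝔽] [CharP 𝔽 p] [TopologicalSpace 𝔽] [DiscreteTopology 𝔽]
    {d : ℕ} (ζ : Fin d → (Gal(Kbar/K) →* 𝔽ˣ)) (hζ_cont : ∀ i, Continuous (ζ i))
    (hζ_one : ∀ i, ζ i ≠ 1) (hζ_cyc : ∀ i, ζ i ≠ modPCyclotomicCharacter p K Kbar 𝔽)
    {W : Type (max v w)} [AddCommGroup W] [Module 𝔽 W]
    [TopologicalSpace W] [DiscreteTopology W] [ContinuousSMul 𝔽 W]
    (ρ : ContRepresentation 𝔽 Gal(Kbar/K) W)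
    (hρ_cont : Continuous fun x : Gal(Kbar/K) × W ↦ ρ x.1 x.2)
    (hρ : IsSuccessiveExtension ρ.toRepresentation ζ) :
    Function.Injective (restrictionMap.{v, w, t} (galInfty K ϖ) (TopRep.of ρ) 1) := by
  have : CharZero K := charZero_of_injective_algebraMap (algebraMap ℚ_[p] K).injective
  have : CharZero Kbar := charZero_of_injective_algebraMap (algebraMap K Kbar).injective
  have := IsAlgClosure.isAlgClosed (K := Kbar) K
  have := IsAlgClosure.isAlgebraic (R := K) (K := Kbar)
  have : Normal K Kbar := IsAlgClosure.normal K Kbar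
  have : IsGalois K Kbar := ⟨⟩
  have hpow (b : K) : b ^ p ≠ π := hπ.pow_ne_of_integralClosure (Fact.out : p.Prime).one_lt b
  have hϖ (n : ℕ) : ϖ n ^ p ^ n = algebraMap K Kbar π :=
    (pow_pow_eq_of_succ_pow_eq hϖ_succ n).trans hϖ_zero
  have hϖ_ne (n : ℕ) : ϖ n ≠ 0 := by
    intro h
    have h1 := hϖ n
    rw [h, zero_pow (pow_ne_zero _ (Fact.out : p.Prime).ne_zero), eq_comm,
      map_eq_zero] at h1
    exact hπ.ne_zero (Subtype.ext h1)
  refine restrictionMap_one_injective (galInfty K ϖ) ρ hρ_cont fun f hf_cont hf hf_zero ↦ ?_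
  obtain ⟨n, hn⟩ := exists_fixingSubgroup_adjoin_subset hϖ_succ
    ((isOpen_discrete {(0 : W)}).preimage hf_cont) hf_zero
  replace hn : ∀ g ∈ (IntermediateField.adjoin K {ϖ n}).fixingSubgroup, f g = 0 := hn
  have key : ∀ g ∈ (IntermediateField.adjoin K {ϖ 0}).fixingSubgroup, f g = 0 := by
    induction n with
    | zero => exact hn
    | succ n ih =>
      refine ih (hρ.crossedHom_eq_zero ?_ (fun i c hc hcx ↦ ?_) hf hn)
      · intro g hg
        rw [mem_fixingSubgroup_adjoin_simple_iff] at hg ⊢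
        rw [← hϖ_succ, map_pow, hg]
      · exact crossedHom_eq_zero_of_adjoin_pow (hζ_cyc i) (hϖ_ne (n + 1)) (hϖ_succ n)
          (index_fixingSubgroup_adjoin_simple hp hpow (hϖ (n + 1))) hc hcx
  intro g
  refine key g (mem_fixingSubgroup_adjoin_simple_iff.2 ?_)
  rw [hϖ_zero, AlgEquiv.commutes]
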